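/- Let $N>0$ be an integer, and let $a_0,\dots,a_N,b_0,\dots,b_N$ be mutually independent real random variables on a probability space, each normally distributed with mean $0$ and variance $1$. Put $\eta_j=a_j+ib_j$. Let $f_0,\dots,f_N$ be analytic functions on $\mathbb{C}$ that are real-valued on the real line, let $S_N(z)=\sum_{j=0}^{N}\eta_j f_j(z)$, and let $U\subseteq\mathbb{C}$ be the open set of points at which $f_0,\dots,f_N$ do not all vanish. For compact $\Phi\subset U$ let $\nu_{N,\mathbf 0}(\Phi)$ be the number of points $z\in\Phi$ with $S_N(z)=0$. Define $$B_{0,N}(z)=\sum_{j=0}^{N}|f_j(z)|^2,\qquad B_{1,N}(z)=\sum_{j=0}^{N}\overline{f_j(z)}\,f_j'(z),\qquad B_{2,N}(z)=\sum_{j=0}^{N}|f_j'(z)|^2 .$$ Call $h:\mathbb{C}\to\mathbb{R}$ an expected density of the complex zeros of $S_N$ if, for every compact $\Phi\subset U$, $\nu_{N,\mathbf 0}(\Phi)$ is a random variable with finite expectation, $h$ is integrable over $\Phi$, and $\mathscr{E}\nu_{N,\mathbf 0}(\Phi)=\int_\Phi h(z)\,dz$, where $dz$ is Lebesgue area measure.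 Then $$h_{N,\mathbf 0}(z)=\frac{B_{0,N}(z)B_{2,N}(z)-|B_{1,N}(z)|^2}{\pi B_{0,N}(z)^2}$$ is an expected density of the complex zeros of $S_N$. Moreover it is unique: every expected density of the complex zeros of $S_N$ equals $h_{N,\mathbf 0}$ almost everywhere on $U$, and everywhere on $U$ if it is continuous on $U$. -/

import Mathlib

open MeasureTheory ProbabilityTheory
open scoped ENNReal

noncomputable section

namespace RandomSum

variable {Ω : Type*} [MeasurableSpace Ω] {N : ℕ}

/-- The random coefficient `η_j = a_j + i b_j`. -/
def coeff (a b : Fin (N + 1) → Ω → ℝ) (j : Fin (N + 1)) (ω : Ω) : ℂ :=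
  (a j ω : ℂ) + Complex.I * (b j ω : ℂ)

/-- The random sum `S_N(z) = ∑_{j=0}^N η_j f_j(z)`. -/
def randomSum (f : Fin (N + 1) → ℂ → ℂ) (a b : Fin (N + 1) → Ω → ℝ) (ω : Ω) (z : ℂ) : ℂ :=
  ∑ j, coeff a b j ω * f j z

/-- `ν_{N,K}(Φ)`: the number of points of `Φ` at which `S_N(z) = K` (possibly infinite). -/
def zeroCount (f : Fin (N + 1) → ℂ → ℂ) (a b : Fin (N + 1) → Ω → ℝ) (K : ℂ) (Φ : Set ℂ)
    (ω : Ω) : ℝ≥0∞ :=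
  (({z ∈ Φ | randomSum f a b ω z = K}.encard : ℕ∞) : ℝ≥0∞)

/-- The expected number of solutions of `S_N(z) = K` in `Φ`. -/
def expectedZeroCount (P : Measure Ω) (f : Fin (N + 1) → ℂ → ℂ) (a b : Fin (N + 1) → Ω → ℝ)
    (K : ℂ) (Φ : Set ℂ) : ℝ≥0∞ :=
  ∫⁻ ω, zeroCount f a b K Φ ω ∂P

/-- The set of points that are not common zeros of the `f_j`. -/
def noCommonZero (f : Fin (N + 1) → ℂ → ℂ) : Set ℂ := {z | ∃ j, f j z ≠ 0}

/-- `h` is an expected density of the complex zeros of `S_N(z) = K`: for each compact set `Φ`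
without common zeros of the `f_j`, the number of zeros in `Φ` is a random variable with finite
expectation, and this expectation is the (area) integral of `h` over `Φ`. -/
def IsExpectedDensity (P : Measure Ω) (f : Fin (N + 1) → ℂ → ℂ) (a b : Fin (N + 1) → Ω → ℝ)
    (K : ℂ) (h : ℂ → ℝ) : Prop :=
  ∀ Φ : Set ℂ, IsCompact Φ → Φ ⊆ noCommonZero f →
    AEMeasurable (zeroCount f a b K Φ) P ∧
    expectedZeroCount P f a b K Φ < ∞ ∧
    IntegrableOn h Φ volume ∧
    (expectedZeroCount P f a b K Φ).toReal = ∫ z in Φ, h z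

/-- `B_{0,N}(z) = ∑ |f_j(z)|²`. -/
def B₀ (f : Fin (N + 1) → ℂ → ℂ) (z : ℂ) : ℝ := ∑ j, ‖f j z‖ ^ 2

/-- `B_{1,N}(z) = ∑ conj(f_j(z)) f_j'(z)`. -/
def B₁ (f : Fin (N + 1) → ℂ → ℂ) (z : ℂ) : ℂ := ∑ j, starRingEnd ℂ (f j z) * deriv (f j) z

/-- `B_{2,N}(z) = ∑ |f_j'(z)|²`. -/
def B₂ (f : Fin (N + 1) → ℂ → ℂ) (z : ℂ) : ℝ := ∑ j, ‖deriv (f j) z‖ ^ 2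

end RandomSum

end

/-! Condition on all coefficients but one. Fix `k` with `f k` not identically zero. Away from the
finitely many zeros of `f k` in `Φ`, a zero of the random sum is a point where the meromorphic
function `F = -∑ η_j u_j`, with `u_j = f_j / f_k` and `j ≠ k`, takes the value `η_k`. The zeros of
`f k` themselves contribute almost surely nothing.

Given the other coefficients, the expected count is the integral over `w` of the number of solutions
of `F z = w` against the Gaussian density of `η_k`. The area formula with multiplicity
(`lintegral_encard_fiber_mul`) turns it into the integral over `z` of `|F'|²` times that density at
`F z`. By Tonelli the remaining expectation can be taken at fixed `z`, where it involves only two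
Gaussian linear forms. Splitting the second into a multiple of the first plus an independent part
(`map_linear_forms_pi`) gives `lintegral_norm_sq_mul_pdf` in closed form. `density_div` shows that
the result no longer depends on `k`.

For uniqueness, integrals over compact subsets determine a locally integrable function almost
everywhere. Since the stated density is continuous off the common zeros, a continuous competitor
agrees with it everywhere there. -/

namespace RandomSum

/-! ### Area formula with multiplicity for complex differentiable functions -/

/-- Multiplication by `c` on `ℂ`, as a real-linear map, has determinant `|c|²`. -/
lemma det_smul_one (c : ℂ) : (c • (1 : ℂ →L[ℝ] ℂ)).det = ‖c‖ ^ 2 := by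
  have h : ((c • (1 : ℂ →L[ℝ] ℂ) : ℂ →L[ℝ] ℂ) : ℂ →ₗ[ℝ] ℂ) = Algebra.lmul ℝ ℂ c := by
    ext; simp
  rw [ContinuousLinearMap.det, h, ← Algebra.norm_apply, Algebra.norm_complex_apply,
    Complex.normSq_eq_norm_sq]

/-- A function which is close enough to a nonzero complex multiplication is injective. -/
lemma injOn_of_approximatesLinearOn {f : ℂ → ℂ} {c : ℂ} (hc : c ≠ 0) {s : Set ℂ}
    (h : ApproximatesLinearOn f (c • (1 : ℂ →L[ℝ] ℂ)) s (‖c‖₊ / 2)) : s.InjOn f := by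
  intro x hx y hy hxy
  have h1 := h x hx y hy
  rw [hxy, sub_self, zero_sub, norm_neg] at h1
  have h2 : ‖(c • (1 : ℂ →L[ℝ] ℂ)) (x - y)‖ = ‖c‖ * ‖x - y‖ := by simp
  rw [h2] at h1
  push_cast at h1
  have hc' : 0 < ‖c‖ := norm_pos_iff.2 hc
  have h3 : ‖x - y‖ ≤ 0 := by
    by_contra! h4
    nlinarith [mul_pos hc' h4]
  exact sub_eq_zero.1 (norm_le_zero_iff.1 h3)

/-- The points of a set where an injective function takes a given value. -/
lemma encard_fiber_of_injOn {f : ℂ → ℂ} {s : Set ℂ} (h : s.InjOn f) (w : ℂ) :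
    (({z ∈ s | f z = w}.encard : ℕ∞) : ℝ≥0∞) = (f '' s).indicator 1 w := by
  classical
  by_cases hw : w ∈ f '' s
  · rw [Set.indicator_of_mem hw]
    obtain ⟨z, hz, rfl⟩ := hw
    have : {x ∈ s | f x = f z} = {z} := by
      ext x
      exact ⟨fun hx => h hx.1 hz hx.2, by rintro rfl; exact ⟨hz, rfl⟩⟩
    simp [this]
  · rw [Set.indicator_of_notMem hw]
    have : {x ∈ s | f x = w} = ∅ := by
      ext x
      simp only [Set.mem_ofPred_eq, Set.mem_empty_iff_false, iff_false, not_and]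
      exact fun hx hxw => hw ⟨x, hx, hxw⟩
    simp [this]

lemma toENNReal_encard_eq_count (s : Set ℂ) : ((s.encard : ℕ∞) : ℝ≥0∞) = Measure.count s := by
  by_cases hs : s.Finite
  · rw [Measure.count_apply hs.measurableSet]
  · rw [Measure.count_apply_infinite hs, Set.encard_eq_top_iff.2 hs]; rfl

/-- The area formula for a function which is complex differentiable on a measurable set. -/
theorem lintegral_encard_fiber_mul {f f' : ℂ → ℂ} {s : Set ℂ} (hs : MeasurableSet s)
    (hf : ∀ z ∈ s, HasDerivAt f (f' z) z) {g : ℂ → ℝ≥0∞} (hg : Measurable g) :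
    ∫⁻ w, (({z ∈ s | f z = w}.encard : ℕ∞) : ℝ≥0∞) * g w =
      ∫⁻ z in s, ENNReal.ofReal (‖f' z‖ ^ 2) * g (f z) := by
  classical
  set s₀ := s ∩ {z | deriv f z = 0} with hs₀
  set s₁ := s \ {z | deriv f z = 0} with hs₁
  have hm : MeasurableSet {z | deriv f z = 0} := measurable_deriv f (measurableSet_singleton 0)
  have ms₁ : MeasurableSet s₁ := hs.diff hm
  have ms₀ : MeasurableSet s₀ := hs.inter hm
  have hd : ∀ z ∈ s, HasFDerivAt f (f' z • (1 : ℂ →L[ℝ] ℂ)) z := fun z hz =>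
    (hf z hz).complexToReal_fderiv
  -- Evaluating a multiplication map at `1` recovers its multiplier, so `‖A 1‖₊ / 2` is the
  -- tolerance that forces injectivity. The value `1` is a dummy, since the tolerance must be
  -- positive for every `A`; it is not used on `s₁`, where the derivative is nonzero.
  obtain ⟨t, A, t_disj, t_meas, st, happ, hA⟩ :=
    exists_partition_approximatesLinearOn_of_hasFDerivWithinAt f s₁
      (fun z => f' z • (1 : ℂ →L[ℝ] ℂ)) (fun z hz => (hd z hz.1).hasFDerivWithinAt)
      (fun A => if A 1 = 0 then 1 else ‖A 1‖₊ / 2) (by intro A; split_ifs <;> simp_all)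
  have hinj : ∀ n, (s₁ ∩ t n).InjOn f := by
    intro n
    rcases s₁.eq_empty_or_nonempty with h0 | h0
    · simp [h0]
    obtain ⟨y, hy, hAy⟩ := hA h0 n
    have hy0 : f' y ≠ 0 := by
      rw [← (hf y hy.1).deriv]; exact hy.2
    have := happ n
    rw [hAy] at this
    simp only [smul_apply, one_apply_eq_self, smul_eq_mul,
      mul_one, hy0, if_false] at this
    exact injOn_of_approximatesLinearOn hy0 this
  have hs₁U : s₁ = ⋃ n, s₁ ∩ t n := by rw [← Set.inter_iUnion, Set.inter_eq_left.2 st]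
  have hdisj : Pairwise (Function.onFun Disjoint fun n => s₁ ∩ t n) := fun i j hij =>
    (t_disj hij).mono Set.inter_subset_right Set.inter_subset_right
  have mst : ∀ n, MeasurableSet (s₁ ∩ t n) := fun n => ms₁.inter (t_meas n)
  -- Sard: critical values form a null set, so for almost every `w` the whole fibre lies in `s₁`.
  have h0 : volume (f '' s₀) = 0 := by
    apply addHaar_image_eq_zero_of_det_fderivWithin_eq_zero volume
      (fun z hz => (hd z hz.1).hasFDerivWithinAt)
    intro z hz
    have : f' z = 0 := by rw [← (hf z hz.1).deriv]; exact hz.2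
    simp [det_smul_one, this]
  have hae : ∀ᵐ w, (({z ∈ s | f z = w}.encard : ℕ∞) : ℝ≥0∞) * g w =
      ∑' n, (f '' (s₁ ∩ t n)).indicator 1 w * g w := by
    filter_upwards [measure_eq_zero_iff_ae_notMem.1 h0] with w hw
    rw [ENNReal.tsum_mul_right]
    congr 1
    simp_rw [← encard_fiber_of_injOn (hinj _)]
    have h1 : {z ∈ s | f z = w} = ⋃ n, {z ∈ s₁ ∩ t n | f z = w} := by
      ext z
      simp only [Set.mem_ofPred_eq, Set.mem_iUnion]
      constructor
      · rintro ⟨hz, hzw⟩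
        have hz1 : z ∈ s₁ := ⟨hz, fun h => hw ⟨z, ⟨hz, h⟩, hzw⟩⟩
        rw [hs₁U] at hz1
        obtain ⟨n, hn⟩ := Set.mem_iUnion.1 hz1
        exact ⟨n, hn, hzw⟩
      · rintro ⟨n, hn, hzw⟩
        exact ⟨hn.1.1, hzw⟩
    -- Viewing cardinality as counting measure makes it countably additive over the pieces of the
    -- fibre, each of which has at most one point.
    simp_rw [toENNReal_encard_eq_count]
    rw [h1, measure_iUnion]
    · exact fun i j hij => (hdisj hij).mono (fun z hz => hz.1) (fun z hz => hz.1)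
    · intro n
      exact (hinj n).mono (fun z hz => hz.1) |> fun h =>
        (Set.Subsingleton.measurableSet fun x hx y hy => h hx hy (hx.2.trans hy.2.symm))
  have mim : ∀ n, MeasurableSet (f '' (s₁ ∩ t n)) := fun n =>
    measurable_image_of_fderivWithin (mst n)
      (fun z hz => (hd z hz.1.1).hasFDerivWithinAt) (hinj n)
  rw [lintegral_congr_ae hae, lintegral_tsum]
  · have h2 : ∀ n, ∫⁻ w, (f '' (s₁ ∩ t n)).indicator 1 w * g w =
        ∫⁻ z in s₁ ∩ t n, ENNReal.ofReal (‖f' z‖ ^ 2) * g (f z) := by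
      intro n
      have := lintegral_image_eq_lintegral_abs_det_fderiv_mul volume (mst n)
        (fun z hz => (hd z hz.1.1).hasFDerivWithinAt) (hinj n) g
      simp_rw [det_smul_one] at this
      rw [← lintegral_indicator (mim n)] at this
      refine Eq.trans (lintegral_congr fun w => ?_) (this.trans (lintegral_congr fun z => ?_))
      · by_cases hw : w ∈ f '' (s₁ ∩ t n) <;> simp [hw]
      · rw [abs_of_nonneg (by positivity)]
    simp_rw [h2]
    rw [← lintegral_iUnion mst hdisj, ← hs₁U, ← lintegral_inter_add_sdiff _ s hm]
    have : ∫⁻ z in s₀, ENNReal.ofReal (‖f' z‖ ^ 2) * g (f z) = 0 := by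
      rw [setLIntegral_congr_fun ms₀ (g := fun _ => 0)]
      · simp
      · intro z hz
        have : f' z = 0 := by rw [← (hf z hz.1).deriv]; exact hz.2
        simp [this]
    rw [this, zero_add]
  · intro n
    exact ((measurable_one.indicator (mim n)).mul hg).aemeasurable

/-! ### Measurability of the number of zeros -/

/-- The parameters for which a jointly continuous function has a zero in a compact set form a
closed set. -/
lemma isClosed_exists_zero {X : Type*} [TopologicalSpace X] {G : X × ℂ → ℂ} (hG : Continuous G)
    {K : Set ℂ} (hK : IsCompact K) : IsClosed {x | ∃ z ∈ K, G (x, z) = 0} := by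
  have : CompactSpace K := isCompact_iff_compactSpace.1 hK
  have h1 : IsClosed {p : X × K | G (p.1, p.2) = 0} :=
    isClosed_singleton.preimage (f := fun p : X × K => G (p.1, p.2)) (by fun_prop)
  have h2 : {x | ∃ z ∈ K, G (x, z) = 0} = Prod.fst '' {p : X × K | G (p.1, p.2) = 0} := by
    ext x
    constructor
    · rintro ⟨z, hz, h⟩
      exact ⟨(x, ⟨z, hz⟩), h, rfl⟩
    · rintro ⟨⟨y, z⟩, h, rfl⟩
      exact ⟨z, z.2, h⟩
  rw [h2]
  exact isClosedMap_fst_of_compactSpace _ h1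

/-- The number of points of a set `Z` is the supremum of the numbers of balls of disjoint families
of small balls that meet `Z`. -/
lemma encard_eq_iSup_balls (Z : Set ℂ) :
    ((Z.encard : ℕ∞) : ℝ≥0∞) = ⨆ (n : ℕ) (s : Finset ℕ)
      (_ : (s : Set ℕ).PairwiseDisjoint fun i =>
        Metric.closedBall (TopologicalSpace.denseSeq ℂ i) (1 / ((n : ℝ) + 1))),
      ∑ i ∈ s, {i | ∃ z ∈ Z, z ∈ Metric.closedBall (TopologicalSpace.denseSeq ℂ i)
        (1 / ((n : ℝ) + 1))}.indicator (1 : ℕ → ℝ≥0∞) i := by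
  classical
  apply le_antisymm
  · rw [← ENNReal.tsum_set_one, ENNReal.tsum_eq_iSup_sum]
    refine iSup_le fun T => ?_
    -- Each point is within one radius of its chosen centre, so a separation of more than four radii
    -- keeps the centres more than two radii apart and the closed balls disjoint.
    have hev : ∀ᶠ n : ℕ in Filter.atTop, ∀ x ∈ T, ∀ y ∈ T, x ≠ y →
        4 * (1 / ((n : ℝ) + 1)) < dist (x : ℂ) y := by
      rw [Filter.eventually_all_finset]
      intro x _
      rw [Filter.eventually_all_finset]
      intro y _
      by_cases hxy : x = y
      · simp [hxy]
      · have h0 : 0 < dist (x : ℂ) y := dist_pos.2 fun h => hxy (Subtype.ext h)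
        have ht := (tendsto_one_div_add_atTop_nhds_zero_nat (𝕜 := ℝ)).const_mul 4
        rw [mul_zero] at ht
        filter_upwards [ht.eventually_lt_const h0] with n hn _ using hn
    obtain ⟨n, hn⟩ := hev.exists
    have hpos : 0 < 1 / ((n : ℝ) + 1) := by positivity
    have hdense : ∀ x : Z, ∃ i, dist (x : ℂ) (TopologicalSpace.denseSeq ℂ i) <
        1 / ((n : ℝ) + 1) := fun x =>
      (TopologicalSpace.denseRange_denseSeq ℂ).exists_dist_lt x hpos
    choose i hi using hdense
    have hdisj : ∀ x ∈ T, ∀ y ∈ T, x ≠ y →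
        Disjoint (Metric.closedBall (TopologicalSpace.denseSeq ℂ (i x)) (1 / ((n : ℝ) + 1)))
          (Metric.closedBall (TopologicalSpace.denseSeq ℂ (i y)) (1 / ((n : ℝ) + 1))) := by
      intro x hx y hy hxy
      apply Metric.closedBall_disjoint_closedBall
      have h1 := hn x hx y hy hxy
      have h2 := dist_triangle4 (x : ℂ) (TopologicalSpace.denseSeq ℂ (i x))
        (TopologicalSpace.denseSeq ℂ (i y)) y
      have h3 := hi y
      rw [dist_comm] at h3
      linarith [hi x]
    have hinj : Set.InjOn i T := by
      intro x hx y hy hxy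
      by_contra hne
      have := hdisj x hx y hy hne
      rw [hxy, disjoint_self] at this
      exact (Metric.nonempty_closedBall.2 hpos.le).ne_empty this
    refine le_trans ?_ (le_iSup_of_le n (le_iSup_of_le (T.image i) (le_iSup_of_le ?_ le_rfl)))
    · rw [Finset.sum_image hinj]
      refine Finset.sum_le_sum fun x _ => ?_
      rw [Set.indicator_of_mem]
      · rfl
      · exact ⟨x, x.2, Metric.mem_closedBall.2 (hi x).le⟩
    · rintro _ hx _ hy hxy
      simp only [Finset.coe_image, Set.mem_image] at hx hy
      obtain ⟨x, hx, rfl⟩ := hx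
      obtain ⟨y, hy, rfl⟩ := hy
      exact hdisj x hx y hy fun h => hxy (by rw [h])
  · refine iSup_le fun n => iSup_le fun s => iSup_le fun hs => ?_
    set H := {i | ∃ z ∈ Z, z ∈ Metric.closedBall (TopologicalSpace.denseSeq ℂ i)
        (1 / ((n : ℝ) + 1))} with hH
    have h1 : ∀ i, ∃ z, i ∈ H → z ∈ Z ∧ z ∈ Metric.closedBall (TopologicalSpace.denseSeq ℂ i)
        (1 / ((n : ℝ) + 1)) := fun i => by
      by_cases hi : i ∈ H
      · obtain ⟨z, hz⟩ := hi
        exact ⟨z, fun _ => hz⟩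
      · exact ⟨0, fun h => absurd h hi⟩
    choose p hp using h1
    have hinj : Set.InjOn p (s.filter (· ∈ H)) := by
      intro x hx y hy hxy
      simp only [Finset.coe_filter, Set.mem_ofPred_eq] at hx hy
      by_contra hne
      exact Set.disjoint_left.1 (hs hx.1 hy.1 hne) (hp x hx.2).2 (hxy ▸ (hp y hy.2).2)
    have h2 : ((s.filter (· ∈ H)).image p : Set ℂ) ⊆ Z := by
      intro z hz
      simp only [Finset.coe_image, Set.mem_image, Finset.coe_filter, Set.mem_ofPred_eq] at hz
      obtain ⟨x, hx, rfl⟩ := hz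
      exact (hp x hx.2).1
    have h3 := Set.encard_le_encard h2
    rw [Set.encard_coe_eq_coe_finsetCard, Finset.card_image_of_injOn hinj] at h3
    calc ∑ i ∈ s, H.indicator (1 : ℕ → ℝ≥0∞) i = ((s.filter (· ∈ H)).card : ℝ≥0∞) := by
          simp [Set.indicator_apply]
      _ = (((s.filter (· ∈ H)).card : ℕ∞) : ℝ≥0∞) := by simp
      _ ≤ _ := by exact_mod_cast h3

/-- The number of zeros in a compact set is a Borel function of the parameter. -/
lemma measurable_encard_zeros {X : Type*} [TopologicalSpace X] [MeasurableSpace X]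
    [OpensMeasurableSpace X] {G : X × ℂ → ℂ} (hG : Continuous G) {K : Set ℂ} (hK : IsCompact K) :
    Measurable fun x => (({z ∈ K | G (x, z) = 0}.encard : ℕ∞) : ℝ≥0∞) := by
  classical
  simp_rw [encard_eq_iSup_balls]
  refine Measurable.iSup fun n => Measurable.iSup fun s => Measurable.iSup fun hs => ?_
  refine Finset.measurable_fun_sum _ fun i _ => ?_
  -- Each summand is the indicator of a closed set of parameters, because the part of `K` in a
  -- closed ball is compact.
  have : IsClosed {x | ∃ z ∈ K ∩ Metric.closedBall (TopologicalSpace.denseSeq ℂ i)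
      (1 / ((n : ℝ) + 1)), G (x, z) = 0} :=
    isClosed_exists_zero hG (hK.inter_right Metric.isClosed_closedBall)
  convert (measurable_one (α := ℝ≥0∞)).indicator this.measurableSet using 2 with x
  simp only [Set.indicator_apply, Set.mem_ofPred_eq, Set.mem_inter_iff]
  congr 1
  exact propext ⟨fun ⟨z, h1, h2⟩ => ⟨z, ⟨h1.1, h2⟩, h1.2⟩, fun ⟨z, h1, h2⟩ => ⟨z, ⟨h1.1, h2⟩, h1.2⟩⟩

/-! ### The complex Gaussian law: density, characteristic function, weighted moments -/

/-- The law of `a + ib` for independent standard normal `a`, `b`. -/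
noncomputable def complexGaussian : Measure ℂ :=
  ((gaussianReal 0 1).prod (gaussianReal 0 1)).map Complex.measurableEquivRealProd.symm

instance : IsProbabilityMeasure complexGaussian :=
  Measure.isProbabilityMeasure_map Complex.measurableEquivRealProd.symm.measurable.aemeasurable

/-- The density of the law of `a + ib`. -/
noncomputable def complexGaussianPDF (w : ℂ) : ℝ :=
  (2 * Real.pi)⁻¹ * Real.exp (-(1 / 2) * ‖w‖ ^ 2)

lemma measurable_complexGaussianPDF : Measurable complexGaussianPDF := by
  unfold complexGaussianPDF; fun_prop

lemma complexGaussianPDF_nonneg (w : ℂ) : 0 ≤ complexGaussianPDF w := by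
  unfold complexGaussianPDF; positivity

lemma complexGaussian_eq_withDensity :
    complexGaussian = volume.withDensity fun w => ENNReal.ofReal (complexGaussianPDF w) := by
  have h1 : (gaussianReal 0 1).prod (gaussianReal 0 1) =
      (volume : Measure (ℝ × ℝ)).withDensity
        fun p => gaussianPDF 0 1 p.1 * gaussianPDF 0 1 p.2 := by
    rw [gaussianReal_of_var_ne_zero 0 one_ne_zero,
      prod_withDensity (measurable_gaussianPDF 0 1) (measurable_gaussianPDF 0 1)]
    rfl
  have h2 : ∀ p : ℝ × ℝ, gaussianPDF 0 1 p.1 * gaussianPDF 0 1 p.2 =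
      ENNReal.ofReal (complexGaussianPDF (Complex.measurableEquivRealProd.symm p)) := by
    intro p
    rw [gaussianPDF, gaussianPDF, ← ENNReal.ofReal_mul (gaussianPDFReal_nonneg _ _ _)]
    congr 1
    rw [gaussianPDFReal, gaussianPDFReal, complexGaussianPDF, ← Complex.normSq_eq_norm_sq,
      Complex.normSq_apply, Complex.measurableEquivRealProd_symm_apply]
    have h3 : (√(2 * Real.pi * ((1 : NNReal) : ℝ)))⁻¹ * (√(2 * Real.pi * ((1 : NNReal) : ℝ)))⁻¹ =
        (2 * Real.pi)⁻¹ := by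
      rw [← mul_inv, Real.mul_self_sqrt (by positivity)]; simp
    rw [mul_mul_mul_comm, h3, ← Real.exp_add]
    congr 2
    simp
    ring
  ext s hs
  rw [complexGaussian, Measure.map_apply Complex.measurableEquivRealProd.symm.measurable hs, h1,
    withDensity_apply _ (Complex.measurableEquivRealProd.symm.measurable hs),
    withDensity_apply _ hs]
  simp_rw [h2]
  exact (Complex.volume_preserving_equiv_real_prod.symm).setLIntegral_comp_preimage hs
    measurable_complexGaussianPDF.ennreal_ofReal

lemma integral_complexGaussian (φ : ℂ → ℝ) :
    ∫ w, φ w ∂complexGaussian = ∫ w, complexGaussianPDF w * φ w := by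
  rw [complexGaussian_eq_withDensity, integral_withDensity_eq_integral_toReal_smul
    (by have := measurable_complexGaussianPDF; fun_prop) (by simp)]
  simp [ENNReal.toReal_ofReal, complexGaussianPDF_nonneg]

lemma charFun_complexGaussian (t : ℂ) :
    charFun complexGaussian t = Complex.exp (-(‖t‖ ^ 2 / 2)) := by
  rw [charFun_apply, complexGaussian,
    integral_map_equiv]
  have : ∀ p : ℝ × ℝ, Complex.exp
      ((inner ℝ (Complex.measurableEquivRealProd.symm p) t : ℝ) * Complex.I) =
      Complex.exp (t.re * p.1 * Complex.I) * Complex.exp (t.im * p.2 * Complex.I) := by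
    intro p
    rw [← Complex.exp_add, Complex.inner, Complex.measurableEquivRealProd_symm_apply]
    congr 1
    simp
    ring
  simp_rw [this]
  rw [integral_prod_mul (fun x : ℝ => Complex.exp (t.re * x * Complex.I))
    (fun x : ℝ => Complex.exp (t.im * x * Complex.I)), ← charFun_apply_real, ← charFun_apply_real,
    charFun_gaussianReal, charFun_gaussianReal, ← Complex.exp_add]
  congr 1
  have h : (‖t‖ ^ 2 : ℂ) = t.re ^ 2 + t.im ^ 2 := by
    rw [← Complex.ofReal_pow, ← Complex.normSq_eq_norm_sq, Complex.normSq_apply]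
    push_cast; ring
  rw [h]
  simp
  ring

/-- The weight only changes the Gaussian exponent from `1 / 2` to `(1 + A) / 2`. Up to a constant,
it is the density of the law evaluated at `√A * w`, which is how it arises later. -/
lemma integral_exp_neg_mul_norm_sq {A : ℝ} (hA : 0 ≤ A) :
    ∫ w, Real.exp (-(A / 2) * ‖w‖ ^ 2) ∂complexGaussian = (1 + A)⁻¹ := by
  have h := Complex.integral_exp_neg_mul_rpow (p := 2) (b := (1 + A) / 2) (by norm_num)
    (by positivity)
  rw [integral_complexGaussian]
  simp_rw [complexGaussianPDF, mul_assoc, ← Real.exp_add]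
  rw [integral_const_mul]
  have h1 : ∀ w : ℂ, -(1 / 2) * ‖w‖ ^ 2 + -(A / 2) * ‖w‖ ^ 2 = -((1 + A) / 2) * ‖w‖ ^ (2 : ℝ) := by
    intro w; rw [Real.rpow_two]; ring
  simp_rw [h1, h]
  norm_num
  rw [Real.rpow_neg_one]
  field_simp

lemma integral_norm_sq_mul_exp_neg_mul_norm_sq {A : ℝ} (hA : 0 ≤ A) :
    ∫ w, ‖w‖ ^ 2 * Real.exp (-(A / 2) * ‖w‖ ^ 2) ∂complexGaussian = 2 / (1 + A) ^ 2 := by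
  have h := Complex.integral_rpow_mul_exp_neg_mul_rpow (p := 2) (q := 2) (b := (1 + A) / 2)
    (by norm_num) (by norm_num) (by positivity)
  rw [integral_complexGaussian]
  have h1 : ∀ w : ℂ, complexGaussianPDF w * (‖w‖ ^ 2 * Real.exp (-(A / 2) * ‖w‖ ^ 2)) =
      (2 * Real.pi)⁻¹ * (‖w‖ ^ (2 : ℝ) * Real.exp (-((1 + A) / 2) * ‖w‖ ^ (2 : ℝ))) := by
    intro w
    rw [Real.rpow_two, complexGaussianPDF, show -((1 + A) / 2) * ‖w‖ ^ 2 =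
      -(1 / 2) * ‖w‖ ^ 2 + -(A / 2) * ‖w‖ ^ 2 by ring, Real.exp_add]
    ring
  simp_rw [h1]
  rw [integral_const_mul, h]
  norm_num
  field_simp

/-! ### Linear forms in independent complex Gaussian variables -/

lemma inner_mul_left_eq_inner_conj_mul (x u t : ℂ) :
    inner ℝ (x * u) t = inner ℝ x (starRingEnd ℂ u * t) := by
  simp only [Complex.inner, map_mul]
  congr 1
  ring

/-- The joint law of two complex linear forms with orthogonal coefficient vectors is that of two
independent Gaussian variables. -/
lemma map_linear_forms_pi {ι : Type*} [Fintype ι] {u w : ι → ℂ}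
    (h : ∑ j, starRingEnd ℂ (u j) * w j = 0) :
    (Measure.pi fun _ : ι => complexGaussian).map
        (fun η => (∑ j, η j * u j, ∑ j, η j * w j)) =
      (complexGaussian.prod complexGaussian).map
        (fun p => ((√(∑ j, ‖u j‖ ^ 2) : ℂ) * p.1, (√(∑ j, ‖w j‖ ^ 2) : ℂ) * p.2)) := by
  have m1 : Measurable fun η : ι → ℂ => (∑ j, η j * u j, ∑ j, η j * w j) := by fun_prop
  have m2 : Measurable fun p : ℂ × ℂ =>
      ((√(∑ j, ‖u j‖ ^ 2) : ℂ) * p.1, (√(∑ j, ‖w j‖ ^ 2) : ℂ) * p.2) := by fun_prop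
  have := Measure.isProbabilityMeasure_map (μ := Measure.pi fun _ : ι => complexGaussian)
    m1.aemeasurable
  have := Measure.isProbabilityMeasure_map (μ := complexGaussian.prod complexGaussian)
    m2.aemeasurable
  apply Measure.ext_of_charFunDual
  ext L
  set t : ℂ := (InnerProductSpace.toDual ℝ ℂ).symm (L.comp (.inl ℝ ℂ ℂ))
  set s : ℂ := (InnerProductSpace.toDual ℝ ℂ).symm (L.comp (.inr ℝ ℂ ℂ))
  have hL : ∀ x y, L (x, y) = inner ℝ x t + inner ℝ y s := by
    intro x y
    rw [real_inner_comm, InnerProductSpace.toDual_symm_apply, real_inner_comm,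
      InnerProductSpace.toDual_symm_apply]
    simp [← map_add]
  rw [charFunDual_apply, charFunDual_apply, integral_map m1.aemeasurable (by fun_prop),
    integral_map m2.aemeasurable (by fun_prop)]
  simp_rw [hL]
  have e1 : ∀ η : ι → ℂ, Complex.exp
      (((inner ℝ (∑ j, η j * u j) t + inner ℝ (∑ j, η j * w j) s : ℝ) : ℂ) * Complex.I) =
      ∏ j, Complex.exp
        ((inner ℝ (η j) (starRingEnd ℂ (u j) * t + starRingEnd ℂ (w j) * s) : ℝ) * Complex.I) := by
    intro η
    rw [← Complex.exp_sum, sum_inner, sum_inner, ← Finset.sum_add_distrib, Complex.ofReal_sum,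
      Finset.sum_mul]
    simp_rw [inner_mul_left_eq_inner_conj_mul, ← inner_add_right]
  have e2 : ∀ p : ℂ × ℂ, Complex.exp
      (((inner ℝ ((√(∑ j, ‖u j‖ ^ 2) : ℂ) * p.1) t +
        inner ℝ ((√(∑ j, ‖w j‖ ^ 2) : ℂ) * p.2) s : ℝ) : ℂ) * Complex.I) =
      Complex.exp ((inner ℝ p.1 ((√(∑ j, ‖u j‖ ^ 2) : ℂ) * t) : ℝ) * Complex.I) *
      Complex.exp ((inner ℝ p.2 ((√(∑ j, ‖w j‖ ^ 2) : ℂ) * s) : ℝ) * Complex.I) := by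
    intro p
    rw [← Complex.exp_add, mul_comm _ p.1, mul_comm _ p.2, inner_mul_left_eq_inner_conj_mul,
      inner_mul_left_eq_inner_conj_mul, Complex.conj_ofReal, Complex.conj_ofReal,
      Complex.ofReal_add, add_mul]
  simp_rw [e1, e2]
  rw [integral_fintype_prod_eq_prod (fun j (x : ℂ) => Complex.exp
        ((inner ℝ x (starRingEnd ℂ (u j) * t + starRingEnd ℂ (w j) * s) : ℝ) * Complex.I)),
    integral_prod_mul
      (fun x : ℂ => Complex.exp ((inner ℝ x ((√(∑ j, ‖u j‖ ^ 2) : ℂ) * t) : ℝ) * Complex.I))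
      (fun x : ℂ => Complex.exp ((inner ℝ x ((√(∑ j, ‖w j‖ ^ 2) : ℂ) * s) : ℝ) * Complex.I))]
  simp_rw [← charFun_apply, charFun_complexGaussian]
  rw [← Complex.exp_sum, ← Complex.exp_add]
  congr 1
  have e3 : ∀ z : ℂ, (‖z‖ ^ 2 : ℂ) = z * starRingEnd ℂ z := fun z => (Complex.mul_conj' z).symm
  have e4 : ∀ v : ι → ℂ, (√(∑ j, ‖v j‖ ^ 2) : ℂ) * √(∑ j, ‖v j‖ ^ 2) =
      ∑ j, v j * starRingEnd ℂ (v j) := by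
    intro v
    rw [← Complex.ofReal_mul, Real.mul_self_sqrt (by positivity)]
    push_cast
    simp_rw [e3]
  -- Expanding the squared norms produces both mixed terms; orthogonality kills one and its
  -- conjugate the other, so the characteristic function factors.
  have h' : ∑ j, u j * starRingEnd ℂ (w j) = 0 := by
    have := congrArg (starRingEnd ℂ) h
    simpa [map_sum] using this
  have e5 : ∀ j, -(((‖starRingEnd ℂ (u j) * t + starRingEnd ℂ (w j) * s‖ : ℝ) : ℂ) ^ 2 / 2) =
      -(1 / 2) * (t * starRingEnd ℂ t * (u j * starRingEnd ℂ (u j)) +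
        s * starRingEnd ℂ s * (w j * starRingEnd ℂ (w j)) +
        t * starRingEnd ℂ s * (starRingEnd ℂ (u j) * w j) +
        s * starRingEnd ℂ t * (u j * starRingEnd ℂ (w j))) := by
    intro j
    rw [e3]
    simp only [map_add, map_mul, Complex.conj_conj]
    ring
  simp_rw [e5, ← Finset.mul_sum, Finset.sum_add_distrib, ← Finset.mul_sum, h, h', ← e4, e3]
  simp only [map_mul, Complex.conj_ofReal]
  ring

/-- The Bochner integral of a non-integrable function is `0` by convention, so an explicit nonzero
value already proves integrability. -/
lemma integrable_of_integral_ne_zero {α : Type*} [MeasurableSpace α] {μ : Measure α} {φ : α → ℝ}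
    (h : ∫ x, φ x ∂μ ≠ 0) : Integrable φ μ :=
  not_imp_comm.1 integral_undef h

lemma integral_norm_sq_complexGaussian :
    Integrable (fun w : ℂ => ‖w‖ ^ 2) complexGaussian ∧ ∫ w, ‖w‖ ^ 2 ∂complexGaussian = 2 := by
  have h := integral_norm_sq_mul_exp_neg_mul_norm_sq le_rfl
  simp at h
  exact ⟨integrable_of_integral_ne_zero (by rw [h]; norm_num), h⟩

lemma integral_inner_complexGaussian (c : ℂ) :
    Integrable (fun w : ℂ => inner ℝ c w) complexGaussian ∧
      ∫ w, inner ℝ c w ∂complexGaussian = 0 := by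
  constructor
  · refine Integrable.mono'
      (g := fun w => ‖c‖ * (1 + ‖w‖ ^ 2)) ?_ (by fun_prop) (ae_of_all _ fun w => ?_)
    · exact ((integrable_const _).add integral_norm_sq_complexGaussian.1).const_mul _
    · refine (norm_inner_le_norm c w).trans ?_
      gcongr
      nlinarith [sq_nonneg (‖w‖ - 1), sq_nonneg ‖w‖]
  -- The integrand is odd, so its integral equals its own negative.
  · rw [integral_complexGaussian]
    have h := integral_neg_eq_self (fun w : ℂ => complexGaussianPDF w * inner ℝ c w) volume
    simp only [complexGaussianPDF, norm_neg, inner_neg_right, mul_neg, integral_neg] at h ⊢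
    linarith

lemma integral_norm_add_mul_sq (p q : ℂ) :
    Integrable (fun w => ‖p + q * w‖ ^ 2) complexGaussian ∧
      ∫ w, ‖p + q * w‖ ^ 2 ∂complexGaussian = ‖p‖ ^ 2 + 2 * ‖q‖ ^ 2 := by
  have h : ∀ w, ‖p + q * w‖ ^ 2 =
      ‖p‖ ^ 2 + (2 * inner ℝ (starRingEnd ℂ q * p) w + ‖q‖ ^ 2 * ‖w‖ ^ 2) := by
    intro w
    rw [norm_add_sq_real, norm_mul, mul_pow, mul_comm q w, real_inner_comm,
      inner_mul_left_eq_inner_conj_mul, real_inner_comm]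
    ring
  simp_rw [h]
  have h1 := integral_norm_sq_complexGaussian
  have h2 := integral_inner_complexGaussian (starRingEnd ℂ q * p)
  have i1 := (h2.1.const_mul 2)
  have i2 := (h1.1.const_mul (‖q‖ ^ 2))
  refine ⟨(integrable_const _).add (i1.add i2), ?_⟩
  calc ∫ w, (‖p‖ ^ 2 + (2 * inner ℝ (starRingEnd ℂ q * p) w + ‖q‖ ^ 2 * ‖w‖ ^ 2)) ∂complexGaussian
      = ∫ _, ‖p‖ ^ 2 ∂complexGaussian +
        ∫ w, (2 * inner ℝ (starRingEnd ℂ q * p) w + ‖q‖ ^ 2 * ‖w‖ ^ 2) ∂complexGaussian :=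
        integral_add (integrable_const _) (i1.add i2)
    _ = ‖p‖ ^ 2 + 2 * ‖q‖ ^ 2 := by
        rw [integral_add i1 i2, integral_const_mul, integral_const_mul, h1.2, h2.2]
        simp
        ring

/-- For two linear forms `X`, `Y` in independent complex Gaussian variables, the expectation of
`|Y|²` weighted by the Gaussian density at `X`. -/
theorem lintegral_norm_sq_mul_pdf {ι : Type*} [Fintype ι] (u v : ι → ℂ) :
    ∫⁻ η, ENNReal.ofReal (‖∑ j, η j * v j‖ ^ 2) *
        ENNReal.ofReal (complexGaussianPDF (∑ j, η j * u j))
        ∂(Measure.pi fun _ : ι => complexGaussian) =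
      ENNReal.ofReal (((1 + ∑ j, ‖u j‖ ^ 2) * ∑ j, ‖v j‖ ^ 2 -
        ‖∑ j, starRingEnd ℂ (u j) * v j‖ ^ 2) / (Real.pi * (1 + ∑ j, ‖u j‖ ^ 2) ^ 2)) := by
  set A := ∑ j, ‖u j‖ ^ 2 with hA
  set D := ∑ j, starRingEnd ℂ (u j) * v j with hD
  have hA0 : 0 ≤ A := by positivity
  have hAc : (A : ℂ) = ∑ j, starRingEnd ℂ (u j) * u j := by
    rw [hA]; push_cast
    exact Finset.sum_congr rfl fun j _ => (Complex.conj_mul' _).symm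
  -- `c` is the coefficient of the orthogonal projection of `v` onto `u`. If `A = 0` then `u = 0`
  -- and `D = 0`, and any `c` would do.
  obtain ⟨c, hc⟩ : ∃ c : ℂ, D = c * A := by
    by_cases h0 : A = 0
    · refine ⟨0, ?_⟩
      have hu : ∀ j, u j = 0 := by
        have := (Finset.sum_eq_zero_iff_of_nonneg (fun j _ => by positivity)).1 h0
        simpa using this
      simp [hD, hu]
    · exact ⟨D / A, by field_simp [Complex.ofReal_ne_zero.2 h0]⟩
  set w : ι → ℂ := fun j => v j - c * u j with hw
  set W := ∑ j, ‖w j‖ ^ 2 with hW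
  have hW0 : 0 ≤ W := by positivity
  have hort : ∑ j, starRingEnd ℂ (u j) * w j = 0 := by
    have : ∀ j, starRingEnd ℂ (u j) * w j =
      starRingEnd ℂ (u j) * v j - c * (starRingEnd ℂ (u j) * u j) := fun j => by
        simp only [hw]; ring
    simp_rw [this]
    rw [Finset.sum_sub_distrib, ← Finset.mul_sum, ← hAc, ← hD, hc, sub_self]
  have hV : ∑ j, ‖v j‖ ^ 2 = ‖c‖ ^ 2 * A + W := by
    have h1 : ∀ j, ‖v j‖ ^ 2 = ‖c‖ ^ 2 * ‖u j‖ ^ 2 + ‖w j‖ ^ 2 +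
        2 * (starRingEnd ℂ c * (starRingEnd ℂ (u j) * w j)).re := by
      intro j
      have : v j = c * u j + w j := by simp [hw]
      rw [this, norm_add_sq_real, norm_mul, mul_pow, Complex.inner, map_mul,
        mul_comm (w j), mul_assoc]
      ring
    simp_rw [h1]
    rw [Finset.sum_add_distrib, Finset.sum_add_distrib, ← Finset.mul_sum, ← Finset.mul_sum,
      ← Complex.re_sum, ← Finset.mul_sum, hort]
    simp [hA, hW]
  have hYX : ∀ η : ι → ℂ, ∑ j, η j * v j = c * ∑ j, η j * u j + ∑ j, η j * w j := by
    intro η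
    rw [Finset.mul_sum, ← Finset.sum_add_distrib]
    exact Finset.sum_congr rfl fun j _ => by simp only [hw]; ring
  have hmeas : Measurable fun p : ℂ × ℂ => ENNReal.ofReal (‖c * p.1 + p.2‖ ^ 2) *
      ENNReal.ofReal (complexGaussianPDF p.1) := by
    have := measurable_complexGaussianPDF
    fun_prop
  have key := lintegral_map (μ := Measure.pi fun _ : ι => complexGaussian) hmeas
    (g := fun η : ι → ℂ => (∑ j, η j * u j, ∑ j, η j * w j)) (by fun_prop)
  simp_rw [hYX]
  rw [← key, map_linear_forms_pi hort, lintegral_map hmeas (by fun_prop), lintegral_prod _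
    (by have := measurable_complexGaussianPDF; fun_prop)]
  have hsq : ∀ {a : ℝ}, 0 ≤ a → ∀ z : ℂ, ‖(√a : ℂ) * z‖ ^ 2 = a * ‖z‖ ^ 2 := by
    intro a ha z
    rw [norm_mul, mul_pow, Complex.norm_real, Real.norm_of_nonneg (Real.sqrt_nonneg a),
      Real.sq_sqrt ha]
  have hinner : ∀ x : ℂ, ∫⁻ y, ENNReal.ofReal (‖c * ((√A : ℂ) * x) + (√W : ℂ) * y‖ ^ 2) *
        ENNReal.ofReal (complexGaussianPDF ((√A : ℂ) * x)) ∂complexGaussian =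
      ENNReal.ofReal ((2 * Real.pi)⁻¹ * ((‖c‖ ^ 2 * A) *
        (‖x‖ ^ 2 * Real.exp (-(A / 2) * ‖x‖ ^ 2)) + 2 * W *
        Real.exp (-(A / 2) * ‖x‖ ^ 2))) := by
    intro x
    have h := integral_norm_add_mul_sq (c * ((√A : ℂ) * x)) (√W : ℂ)
    rw [lintegral_mul_const' _ _ ENNReal.ofReal_ne_top,
      ← ofReal_integral_eq_lintegral_ofReal h.1 (ae_of_all _ fun _ => by positivity), h.2,
      ← ENNReal.ofReal_mul (by positivity)]
    congr 1
    have hW1 : ‖(√W : ℂ)‖ ^ 2 = W := by simpa using hsq hW0 1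
    rw [norm_mul, mul_pow, hsq hA0, hW1, complexGaussianPDF, hsq hA0,
      show -(1 / 2) * (A * ‖x‖ ^ 2) = -(A / 2) * ‖x‖ ^ 2 by ring]
    ring
  change ∫⁻ x, ∫⁻ y, ENNReal.ofReal (‖c * ((√A : ℂ) * x) + (√W : ℂ) * y‖ ^ 2) *
    ENNReal.ofReal (complexGaussianPDF ((√A : ℂ) * x)) ∂complexGaussian ∂complexGaussian = _
  simp_rw [hinner]
  have e1 := integral_exp_neg_mul_norm_sq hA0
  have e2 := integral_norm_sq_mul_exp_neg_mul_norm_sq hA0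
  have i1 := integrable_of_integral_ne_zero (e1.trans_ne (by positivity))
  have i2 := integrable_of_integral_ne_zero (e2.trans_ne (by positivity))
  have i1' := i1.const_mul (2 * W)
  have i2' := i2.const_mul (‖c‖ ^ 2 * A)
  have i3 := (i2'.add i1').const_mul (2 * Real.pi)⁻¹
  refine (ofReal_integral_eq_lintegral_ofReal i3
    (ae_of_all _ fun _ => by simp only [Pi.add_apply, Pi.zero_apply]; positivity)).symm.trans ?_
  congr 1
  rw [integral_const_mul, integral_add' i2' i1', integral_const_mul, integral_const_mul, e1, e2,
    hV, hc, norm_mul, Complex.norm_real, Real.norm_of_nonneg hA0]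
  have := Real.pi_ne_zero
  have : 1 + A ≠ 0 := by positivity
  field_simp
  ring

/-! ### Independence of the density from the function divided by -/

/-- Numerator and denominator of the density are compatible with dividing all functions by one of
them. -/
lemma density_div {N : ℕ} (x y : Fin (N + 1) → ℂ) (k : Fin (N + 1)) (hk : x k ≠ 0)
    (u v : Fin N → ℂ) (hu : ∀ j, u j = x (k.succAbove j) / x k)
    (hv : ∀ j, v j = (y (k.succAbove j) * x k - x (k.succAbove j) * y k) / x k ^ 2) :
    ((1 + ∑ j, ‖u j‖ ^ 2) * ∑ j, ‖v j‖ ^ 2 - ‖∑ j, starRingEnd ℂ (u j) * v j‖ ^ 2) /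
        (Real.pi * (1 + ∑ j, ‖u j‖ ^ 2) ^ 2) =
      ((∑ j, ‖x j‖ ^ 2) * ∑ j, ‖y j‖ ^ 2 - ‖∑ j, starRingEnd ℂ (x j) * y j‖ ^ 2) /
        (Real.pi * (∑ j, ‖x j‖ ^ 2) ^ 2) := by
  -- With this `e`, `v j` is the component of `y - e • x` at `k.succAbove j` divided by `x k`, and
  -- the `k`-th component of `y - e • x` vanishes. Hence the sums over `Fin N` extend to all
  -- indices, and the Gram determinant of `x` and `y` is unchanged by subtracting a multiple of `x`
  -- from `y`.
  set e := y k / x k with he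
  set r := ‖x k‖ ^ 2 with hr
  have hr0 : 0 < r := by positivity
  set P := ∑ j, ‖x j‖ ^ 2 with hP
  set Q := ∑ j, starRingEnd ℂ (x j) * y j with hQ
  set R := ∑ j, ‖y j‖ ^ 2 with hR
  have hrc : (r : ℂ) = starRingEnd ℂ (x k) * x k := by
    rw [hr]; push_cast; exact (Complex.conj_mul' _).symm
  have hPc : (P : ℂ) = ∑ j, starRingEnd ℂ (x j) * x j := by
    rw [hP]; push_cast
    exact Finset.sum_congr rfl fun j _ => (Complex.conj_mul' _).symm
  have hA : 1 + ∑ j, ‖u j‖ ^ 2 = P / r := by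
    rw [hP, Fin.sum_univ_succAbove _ k]
    simp_rw [hu, norm_div, div_pow]
    rw [← Finset.sum_div, ← hr]
    field_simp
  have hxk : starRingEnd ℂ (x k) ≠ 0 := by simpa using hk
  have hD : ∑ j, starRingEnd ℂ (u j) * v j = (Q - e * P) / r := by
    rw [hPc, hQ, Finset.mul_sum, ← Finset.sum_sub_distrib, Fin.sum_univ_succAbove _ k,
      add_div, Finset.sum_div, hrc]
    have : starRingEnd ℂ (x k) * y k - e * (starRingEnd ℂ (x k) * x k) = 0 := by
      rw [he]; field_simp; ring
    rw [this, zero_div, zero_add]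
    refine Finset.sum_congr rfl fun j _ => ?_
    rw [hu, hv, he, map_div₀]
    field_simp
  have hB : ∑ j, ‖v j‖ ^ 2 = (R - 2 * (starRingEnd ℂ e * Q).re + ‖e‖ ^ 2 * P) / r := by
    have h1 : ∀ j, ‖y j - e * x j‖ ^ 2 = ‖y j‖ ^ 2 -
        2 * (starRingEnd ℂ e * (starRingEnd ℂ (x j) * y j)).re + ‖e‖ ^ 2 * ‖x j‖ ^ 2 := by
      intro j
      rw [norm_sub_sq_real, real_inner_comm, Complex.inner, norm_mul, mul_pow, map_mul]
      congr 3
      rw [← Complex.conj_re]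
      simp
      ring
    have h2 : ∑ j, ‖y j - e * x j‖ ^ 2 =
        R - 2 * (starRingEnd ℂ e * Q).re + ‖e‖ ^ 2 * P := by
      simp_rw [h1]
      rw [Finset.sum_add_distrib, Finset.sum_sub_distrib, ← Finset.mul_sum, ← Finset.mul_sum,
        ← Complex.re_sum, ← Finset.mul_sum]
    rw [← h2, Fin.sum_univ_succAbove _ k, add_div, Finset.sum_div]
    have h3 : y k - e * x k = 0 := by rw [he]; field_simp; ring
    rw [h3, norm_zero, zero_pow two_ne_zero, zero_div, zero_add]
    refine Finset.sum_congr rfl fun j _ => ?_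
    have h4 : v j = (y (k.succAbove j) - e * x (k.succAbove j)) / x k := by
      rw [hv, he]; field_simp
    rw [h4, norm_div, div_pow]
  have hN : ‖(Q - e * P) / (r : ℂ)‖ ^ 2 =
      (‖Q‖ ^ 2 - 2 * P * (starRingEnd ℂ e * Q).re + ‖e‖ ^ 2 * P ^ 2) / r ^ 2 := by
    rw [norm_div, div_pow, Complex.norm_real, Real.norm_of_nonneg hr0.le, norm_sub_sq_real,
      norm_mul, Complex.norm_real, mul_pow, Real.norm_eq_abs, sq_abs, real_inner_comm,
      Complex.inner, map_mul, Complex.conj_ofReal, mul_comm Q, mul_right_comm,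
      mul_comm _ (P : ℂ), Complex.re_ofReal_mul]
    ring
  have hP0 : 0 < P := by
    rw [hP, Fin.sum_univ_succAbove _ k]; positivity
  rw [hA, hD, hB, hN]
  have := Real.pi_ne_zero
  field_simp
  ring

/-! ### Expected number of zeros in coefficient space -/

variable {N : ℕ}

/-- The density `(B₀ B₂ - |B₁|²) / (π B₀²)`. -/
noncomputable def zeroDensity (f : Fin (N + 1) → ℂ → ℂ) (z : ℂ) : ℝ :=
  (B₀ f z * B₂ f z - ‖B₁ f z‖ ^ 2) / (Real.pi * B₀ f z ^ 2)

lemma complexGaussian_singleton (w : ℂ) : complexGaussian {w} = 0 := by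
  rw [complexGaussian_eq_withDensity]
  exact withDensity_absolutelyContinuous _ _ (measure_singleton w)

/-- A nontrivial linear form in independent complex Gaussian variables is almost surely nonzero. -/
lemma ae_linear_form_ne_zero {ι : Type*} [Fintype ι] {x : ι → ℂ} (hx : ∃ j, x j ≠ 0) :
    ∀ᵐ η ∂(Measure.pi fun _ : ι => complexGaussian), ∑ j, η j * x j ≠ 0 := by
  -- Pairing with the zero form, which is trivially orthogonal, shows that the form is distributed
  -- as a positive multiple of a single Gaussian, which has no atoms.
  have h := map_linear_forms_pi (u := x) (w := fun _ => 0) (by simp)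
  have hA : (√(∑ j, ‖x j‖ ^ 2) : ℂ) ≠ 0 := by
    obtain ⟨j, hj⟩ := hx
    rw [Complex.ofReal_ne_zero, Real.sqrt_ne_zero']
    exact Finset.sum_pos' (fun _ _ => by positivity) ⟨j, Finset.mem_univ j, by positivity⟩
  have hm : MeasurableSet {p : ℂ × ℂ | p.1 = 0} := measurable_fst (measurableSet_singleton 0)
  have h' := DFunLike.congr_fun h {p : ℂ × ℂ | p.1 = 0}
  rw [Measure.map_apply (by fun_prop) hm, Measure.map_apply (by fun_prop) hm] at h'
  have h0 : (fun p : ℂ × ℂ =>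
      ((√(∑ j, ‖x j‖ ^ 2) : ℂ) * p.1, (√(∑ j : ι, ‖(0 : ℂ)‖ ^ 2) : ℂ) * p.2)) ⁻¹'
        {p | p.1 = 0} = {0} ×ˢ Set.univ := by
    ext p
    simp only [Set.mem_preimage, Set.mem_ofPred_eq, mul_eq_zero, hA, false_or, Set.mem_prod,
      Set.mem_singleton_iff, Set.mem_univ, and_true]
  rw [h0, Measure.prod_prod, complexGaussian_singleton, zero_mul] at h'
  exact measure_eq_zero_iff_ae_notMem.1 h'

/-- The identity theorem makes the zeros isolated, and compactness leaves finitely many. -/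
lemma finite_zeros_of_isCompact {g : ℂ → ℂ} (hg : AnalyticOnNhd ℂ g Set.univ) (h0 : ∃ z, g z ≠ 0)
    {K : Set ℂ} (hK : IsCompact K) : (K ∩ {z | g z = 0}).Finite := by
  rcases hg.eqOn_zero_or_eventually_ne_zero_of_preconnected isPreconnected_univ with h | h
  · obtain ⟨z, hz⟩ := h0
    exact absurd (h (Set.mem_univ z)) hz
  · have h1 : {z | g z ≠ 0} ∈ Filter.codiscreteWithin K :=
      Filter.codiscreteWithin_mono (Set.subset_univ K) h
    convert hK.finite_sdiff_of_mem_codiscreteWithin h1 using 1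
    ext z
    simp

lemma measurable_encard_zeros_linear {f : Fin (N + 1) → ℂ → ℂ} (hf : ∀ j, Continuous (f j))
    {K : Set ℂ} (hK : IsCompact K) :
    Measurable fun η : Fin (N + 1) → ℂ =>
      (({z ∈ K | ∑ j, η j * f j z = 0}.encard : ℕ∞) : ℝ≥0∞) :=
  measurable_encard_zeros (G := fun p : (Fin (N + 1) → ℂ) × ℂ => ∑ j, p.1 j * f j p.2)
    (by fun_prop) hK

/-- The expected number of zeros, for coefficients in the space `ℂ^(N+1)` with Gaussian measure. -/
theorem lintegral_encard_zeros {f : Fin (N + 1) → ℂ → ℂ}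
    (hf : ∀ j, AnalyticOnNhd ℂ (f j) Set.univ) {Φ : Set ℂ} (hΦ : IsCompact Φ)
    (hU : Φ ⊆ noCommonZero f) :
    ∫⁻ η, (({z ∈ Φ | ∑ j, η j * f j z = 0}.encard : ℕ∞) : ℝ≥0∞)
        ∂(Measure.pi fun _ : Fin (N + 1) => complexGaussian) =
      ∫⁻ z in Φ, ENNReal.ofReal (zeroDensity f z) := by
  have hdiff : ∀ j z, HasDerivAt (f j) (deriv (f j) z) z := fun j z =>
    (hf j z (Set.mem_univ z)).differentiableAt.hasDerivAt
  have hcont : ∀ j, Continuous (f j) := fun j =>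
    continuous_iff_continuousAt.2 fun z => (hdiff j z).continuousAt
  by_cases hk : ∃ k z, f k z ≠ 0
  swap
  · push Not at hk
    have : Φ = ∅ := Set.eq_empty_of_forall_notMem fun z hz => by
      obtain ⟨j, hj⟩ := hU hz
      exact hj (hk j z)
    simp [this]
  obtain ⟨k, hk⟩ := hk
  set Z := Φ ∩ {z | f k z = 0} with hZ
  have hZfin : Z.Finite := finite_zeros_of_isCompact (hf k) hk hΦ
  set s := Φ \ Z with hs
  have hsm : MeasurableSet s := hΦ.measurableSet.diff hZfin.measurableSet
  have hs0 : ∀ z ∈ s, f k z ≠ 0 := fun z hz h => hz.2 ⟨hz.1, h⟩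
  set u : Fin N → ℂ → ℂ := fun j z => f (k.succAbove j) z / f k z with hu
  set v : Fin N → ℂ → ℂ := fun j z =>
    (deriv (f (k.succAbove j)) z * f k z - f (k.succAbove j) z * deriv (f k) z) / f k z ^ 2 with hv
  have hum : ∀ j, Measurable (u j) := fun j =>
    (hcont _).measurable.div (hcont k).measurable
  have hvm : ∀ j, Measurable (v j) := fun j =>
    (((measurable_deriv _).mul (hcont k).measurable).sub
      ((hcont _).measurable.mul (measurable_deriv _))).div ((hcont k).measurable.pow_const 2)
  have hF : ∀ (η : Fin N → ℂ), ∀ z ∈ s,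
      HasDerivAt (fun z => -∑ j, η j * u j z) (-∑ j, η j * v j z) z := by
    intro η z hz
    refine (HasDerivAt.fun_sum fun j _ => ?_).neg
    exact ((hdiff _ z).div (hdiff k z) (hs0 z hz)).const_mul (η j)
  have hmp := measurePreserving_piFinSuccAbove (fun _ : Fin (N + 1) => complexGaussian) k
  have hnm := measurable_encard_zeros_linear hcont hΦ
  rw [← hmp.symm.lintegral_comp_emb (MeasurableEquiv.measurableEmbedding _)]
  refine (lintegral_prod_symm _ (hnm.comp (MeasurableEquiv.piFinSuccAbove (fun _ : Fin (N + 1) => ℂ) k).symm.measurable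
      ).aemeasurable).trans ?_
  have hsum : ∀ (w : ℂ) (η : Fin N → ℂ) (z : ℂ),
      ∑ j, (MeasurableEquiv.piFinSuccAbove (fun _ : Fin (N + 1) => ℂ) k).symm (w, η) j * f j z =
        w * f k z + ∑ j, η j * f (k.succAbove j) z := by
    intro w η z
    rw [Fin.sum_univ_succAbove _ k]
    simp [MeasurableEquiv.piFinSuccAbove_symm_apply, Fin.insertNthEquiv]
  -- At a zero of `f k` the sum does not involve `η_k`, and some other `f_j` is nonzero there; the
  -- remaining linear form is then almost surely nonzero, simultaneously at the finitely many points
  -- of `Z`.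
  have hae : ∀ᵐ η ∂(Measure.pi fun _ : Fin N => complexGaussian),
      ∀ z ∈ Z, ∑ j, η j * f (k.succAbove j) z ≠ 0 := by
    rw [ae_ball_iff hZfin.countable]
    intro z hz
    apply ae_linear_form_ne_zero
    obtain ⟨j, hj⟩ := hU hz.1
    rcases Fin.eq_self_or_eq_succAbove k j with rfl | ⟨i, rfl⟩
    · exact absurd hz.2 hj
    · exact ⟨i, hj⟩
  have hinner : ∀ᵐ η ∂(Measure.pi fun _ : Fin N => complexGaussian),
      ∫⁻ w, (({z ∈ Φ | ∑ j, (MeasurableEquiv.piFinSuccAbove (fun _ : Fin (N + 1) => ℂ) k).symm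
        (w, η) j * f j z = 0}.encard : ℕ∞) : ℝ≥0∞) ∂complexGaussian =
      ∫⁻ z in s, ENNReal.ofReal (‖∑ j, η j * v j z‖ ^ 2) *
        ENNReal.ofReal (complexGaussianPDF (∑ j, η j * u j z)) := by
    filter_upwards [hae] with η hη
    have hset : ∀ w, {z ∈ Φ | ∑ j, (MeasurableEquiv.piFinSuccAbove
        (fun _ : Fin (N + 1) => ℂ) k).symm (w, η) j * f j z = 0} =
        {z ∈ s | -∑ j, η j * u j z = w} := by
      intro w
      ext z
      simp only [hsum, Set.mem_ofPred_eq]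
      have hdiv : f k z ≠ 0 → ∑ j, η j * u j z = (∑ j, η j * f (k.succAbove j) z) / f k z := by
        intro _
        rw [Finset.sum_div]
        exact Finset.sum_congr rfl fun j _ => by simp only [hu]; ring
      constructor
      · rintro ⟨hz, h⟩
        have hzs : z ∈ s := by
          refine ⟨hz, fun hzZ => hη z hzZ ?_⟩
          have h0 : f k z = 0 := hzZ.2
          simpa [h0] using h
        refine ⟨hzs, ?_⟩
        rw [hdiv (hs0 z hzs), eq_neg_of_add_eq_zero_right h, neg_div, neg_neg,
          mul_div_cancel_right₀ _ (hs0 z hzs)]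
      · rintro ⟨hz, rfl⟩
        refine ⟨hz.1, ?_⟩
        rw [hdiv (hs0 z hz), neg_mul, div_mul_cancel₀ _ (hs0 z hz), neg_add_cancel]
    simp_rw [hset]
    rw [complexGaussian_eq_withDensity, lintegral_withDensity_eq_lintegral_mul_non_measurable _
      measurable_complexGaussianPDF.ennreal_ofReal (by simp)]
    simp only [Pi.mul_apply, mul_comm (ENNReal.ofReal (complexGaussianPDF _))]
    rw [lintegral_encard_fiber_mul hsm (hF η) measurable_complexGaussianPDF.ennreal_ofReal]
    simp only [norm_neg, complexGaussianPDF]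
  refine (lintegral_congr_ae hinner).trans ?_
  -- After Tonelli, the expectation over the remaining coefficients is taken at a fixed `z`.
  rw [lintegral_lintegral_swap]
  · have hd : ∀ z ∈ s, ∫⁻ η, ENNReal.ofReal (‖∑ j, η j * v j z‖ ^ 2) *
        ENNReal.ofReal (complexGaussianPDF (∑ j, η j * u j z))
          ∂(Measure.pi fun _ : Fin N => complexGaussian) = ENNReal.ofReal (zeroDensity f z) := by
      intro z hz
      rw [lintegral_norm_sq_mul_pdf (fun j => u j z) (fun j => v j z),
        density_div (fun j => f j z) (fun j => deriv (f j) z) k (hs0 z hz) _ _ (fun _ => rfl)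
          (fun _ => rfl)]
      rfl
    rw [setLIntegral_congr_fun hsm hd]
    exact setLIntegral_congr (sdiff_null_ae_eq_self (hZfin.measure_zero volume))
  · have := measurable_complexGaussianPDF
    have h1 : Measurable fun p : (Fin N → ℂ) × ℂ => ∑ j, p.1 j * v j p.2 :=
      Finset.measurable_fun_sum _ fun j _ =>
        ((measurable_pi_apply j).comp measurable_fst).mul ((hvm j).comp measurable_snd)
    have h2 : Measurable fun p : (Fin N → ℂ) × ℂ => ∑ j, p.1 j * u j p.2 :=
      Finset.measurable_fun_sum _ fun j _ =>
        ((measurable_pi_apply j).comp measurable_fst).mul ((hum j).comp measurable_snd)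
    exact ((h1.norm.pow_const 2).ennreal_ofReal.mul (this.comp h2).ennreal_ofReal).aemeasurable

/-! ### Transfer to the probability space and continuity of the density -/

variable {Ω : Type*} [MeasurableSpace Ω]

lemma measurePreserving_complexGaussian :
    MeasurePreserving Complex.measurableEquivRealProd.symm
      ((gaussianReal 0 1).prod (gaussianReal 0 1)) complexGaussian :=
  ⟨Complex.measurableEquivRealProd.symm.measurable, rfl⟩

/-- The coefficients are independent standard complex Gaussian variables. -/
lemma map_coeff (P : Measure Ω) [IsProbabilityMeasure P] (a b : Fin (N + 1) → Ω → ℝ)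
    (ha : ∀ j, HasLaw (a j) (gaussianReal 0 1) P)
    (hb : ∀ j, HasLaw (b j) (gaussianReal 0 1) P)
    (hindep : iIndepFun (Sum.elim a b) P) :
    AEMeasurable (fun ω j => coeff a b j ω) P ∧
      P.map (fun ω j => coeff a b j ω) = Measure.pi fun _ => complexGaussian := by
  have hlaw : ∀ i, HasLaw (Sum.elim a b i) (gaussianReal 0 1) P := by
    rintro (i | i)
    exacts [ha i, hb i]
  have h1 := hindep.map_fun_eq_pi_map fun i => (hlaw i).aemeasurable
  simp_rw [(hlaw _).map_eq] at h1
  have m1 := measurePreserving_sumPiEquivProdPi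
    (fun _ : Fin (N + 1) ⊕ Fin (N + 1) => gaussianReal 0 1)
  have m2 := (measurePreserving_arrowProdEquivProdArrow ℝ ℝ (Fin (N + 1))
    (fun _ => gaussianReal 0 1) (fun _ => gaussianReal 0 1)).symm
  have m3 := measurePreserving_pi (fun _ : Fin (N + 1) => (gaussianReal 0 1).prod (gaussianReal 0 1))
    (fun _ => complexGaussian) fun _ => measurePreserving_complexGaussian
  have m4 := m3.comp (m2.comp m1)
  have hae : AEMeasurable (fun ω i => Sum.elim a b i ω) P :=
    aemeasurable_pi_lambda _ fun i => (hlaw i).aemeasurable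
  have hcomp : (fun ω j => coeff a b j ω) =
      ((fun x j => Complex.measurableEquivRealProd.symm (x j)) ∘
        (MeasurableEquiv.arrowProdEquivProdArrow ℝ ℝ (Fin (N + 1))).symm ∘
          (MeasurableEquiv.sumPiEquivProdPi fun _ => ℝ)) ∘ (fun ω i => Sum.elim a b i ω) := by
    funext ω j
    change (a j ω : ℂ) + Complex.I * b j ω = ⟨a j ω, b j ω⟩
    apply Complex.ext <;> simp
  rw [hcomp]
  refine ⟨m4.measurable.comp_aemeasurable hae, ?_⟩
  rw [← AEMeasurable.map_map_of_aemeasurable m4.measurable.aemeasurable hae, h1]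
  exact m4.map_eq

lemma B₀_pos {f : Fin (N + 1) → ℂ → ℂ} {z : ℂ} (hz : z ∈ noCommonZero f) : 0 < B₀ f z := by
  obtain ⟨j, hj⟩ := hz
  exact Finset.sum_pos' (fun _ _ => by positivity) ⟨j, Finset.mem_univ j, by positivity⟩

/-- Cauchy–Schwarz for the vectors of values and of derivatives. Nonnegativity lets the extended
integrals of `ENNReal.ofReal` be read as real integrals. -/
lemma zeroDensity_nonneg (f : Fin (N + 1) → ℂ → ℂ) (z : ℂ) : 0 ≤ zeroDensity f z := by
  have h1 : ‖B₁ f z‖ ≤ ∑ j, ‖f j z‖ * ‖deriv (f j) z‖ := by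
    refine (norm_sum_le _ _).trans_eq (Finset.sum_congr rfl fun j _ => ?_)
    rw [norm_mul, RCLike.norm_conj]
  have h2 : ‖B₁ f z‖ ^ 2 ≤ B₀ f z * B₂ f z :=
    (pow_le_pow_left₀ (norm_nonneg _) h1 2).trans (Finset.sum_mul_sq_le_sq_mul_sq _ _ _)
  exact div_nonneg (sub_nonneg.2 h2) (by positivity)

lemma continuousOn_zeroDensity {f : Fin (N + 1) → ℂ → ℂ}
    (hf : ∀ j, AnalyticOnNhd ℂ (f j) Set.univ) :
    ContinuousOn (zeroDensity f) (noCommonZero f) := by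
  have hc : ∀ j, Continuous (f j) := fun j => continuousOn_univ.1 (hf j).continuousOn
  have hc' : ∀ j, Continuous (deriv (f j)) := fun j => continuousOn_univ.1 (hf j).deriv.continuousOn
  have h0 : Continuous (B₀ f) := by unfold B₀; fun_prop
  have h1 : Continuous (B₁ f) := by
    unfold B₁
    exact continuous_finsetSum _ fun j _ => (Complex.continuous_conj.comp (hc j)).mul (hc' j)
  have h2 : Continuous (B₂ f) := by unfold B₂; fun_prop
  refine ContinuousOn.div (by fun_prop) (by fun_prop) fun z hz => ?_
  have := B₀_pos hz
  positivity

lemma isOpen_noCommonZero {f : Fin (N + 1) → ℂ → ℂ} (hf : ∀ j, Continuous (f j)) :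
    IsOpen (noCommonZero f) := by
  have : noCommonZero f = ⋃ j, {z | f j z ≠ 0} := by ext z; simp [noCommonZero]
  rw [this]
  exact isOpen_iUnion fun j => isOpen_ne_fun (hf j) continuous_const

theorem isExpectedDensity_zeroDensity (P : Measure Ω) [IsProbabilityMeasure P]
    (a b : Fin (N + 1) → Ω → ℝ)
    (ha : ∀ j, HasLaw (a j) (gaussianReal 0 1) P)
    (hb : ∀ j, HasLaw (b j) (gaussianReal 0 1) P)
    (hindep : iIndepFun (Sum.elim a b) P) (f : Fin (N + 1) → ℂ → ℂ)
    (hf : ∀ j, AnalyticOnNhd ℂ (f j) Set.univ) :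
    IsExpectedDensity P f a b 0 (zeroDensity f) := by
  intro Φ hΦ hU
  obtain ⟨hm, hmap⟩ := map_coeff P a b ha hb hindep
  have hn := measurable_encard_zeros_linear
    (fun j => continuousOn_univ.1 (hf j).continuousOn) hΦ
  have hint : IntegrableOn (zeroDensity f) Φ volume :=
    ((continuousOn_zeroDensity hf).mono hU).integrableOn_compact hΦ
  have hE : expectedZeroCount P f a b 0 Φ = ENNReal.ofReal (∫ z in Φ, zeroDensity f z) := by
    rw [ofReal_integral_eq_lintegral_ofReal hint (ae_of_all _ (zeroDensity_nonneg f)),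
      ← lintegral_encard_zeros hf hΦ hU, ← hmap, lintegral_map' hn.aemeasurable hm]
    rfl
  refine ⟨hn.comp_aemeasurable hm, ?_, hint, ?_⟩
  · rw [hE]; exact ENNReal.ofReal_lt_top
  · rw [hE, ENNReal.toReal_ofReal (setIntegral_nonneg hΦ.measurableSet
      fun z _ => zeroDensity_nonneg f z)]

/-! ### Uniqueness of the density -/

/-- Two functions on an open set with the same integrals over its compact subsets agree almost
everywhere. -/
lemma ae_eq_of_setIntegral_isCompact_eq {U : Set ℂ} (hU : IsOpen U) {g h : ℂ → ℝ}
    (hg : ∀ K, IsCompact K → K ⊆ U → IntegrableOn g K)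
    (hh : ∀ K, IsCompact K → K ⊆ U → IntegrableOn h K)
    (heq : ∀ K, IsCompact K → K ⊆ U → ∫ z in K, g z = ∫ z in K, h z) :
    g =ᵐ[volume.restrict U] h := by
  -- Intersecting a closed exhaustion of `U` with balls gives countably many compact sets covering
  -- `U`, and it suffices to argue on each.
  obtain ⟨F, hFc, hFU, hFun, -⟩ := hU.exists_iUnion_isClosed
  have hK : ∀ n m : ℕ, IsCompact (F n ∩ Metric.closedBall 0 m) := fun n m =>
    (isCompact_closedBall 0 _).inter_left (hFc n)
  have hUK : U = ⋃ p : ℕ × ℕ, F p.1 ∩ Metric.closedBall 0 p.2 := by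
    rw [← hFun]
    ext z
    simp only [Set.mem_iUnion, Set.mem_inter_iff, Prod.exists, exists_and_left]
    obtain ⟨m, hm⟩ := exists_nat_ge (dist z 0)
    exact ⟨fun ⟨n, hn⟩ => ⟨n, hn, m, hm⟩, fun ⟨n, hn, _⟩ => ⟨n, hn⟩⟩
  rw [hUK]
  refine (ae_restrict_iUnion_iff _ _).2 fun p => ?_
  have hKp := hK p.1 p.2
  have hKU : F p.1 ∩ Metric.closedBall 0 p.2 ⊆ U := Set.inter_subset_left.trans (hFU p.1)
  have : (g - h) =ᵐ[volume.restrict (F p.1 ∩ Metric.closedBall 0 p.2)] 0 := by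
    refine ae_eq_zero_of_forall_setIntegral_isCompact_eq_zero
      ((hg _ hKp hKU).sub (hh _ hKp hKU)) fun s hs => ?_
    -- Integrating over `s` for the restricted measure means integrating over this intersection,
    -- which is a compact subset of `U`, so the hypotheses apply to it.
    have hsK := hs.inter_right hKp.isClosed
    have hsU : s ∩ (F p.1 ∩ Metric.closedBall 0 p.2) ⊆ U := Set.inter_subset_right.trans hKU
    rw [Measure.restrict_restrict' hKp.measurableSet,
      integral_sub' (hg _ hsK hsU) (hh _ hsK hsU), heq _ hsK hsU, sub_self]
  filter_upwards [this] with z hz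
  exact sub_eq_zero.1 hz

end RandomSum

theorem corollary2 {Ω : Type*} [MeasurableSpace Ω] (P : Measure Ω) [IsProbabilityMeasure P]
    (N : ℕ) (hN : 0 < N) (a b : Fin (N + 1) → Ω → ℝ)
    (ha : ∀ j, HasLaw (a j) (gaussianReal 0 1) P)
    (hb : ∀ j, HasLaw (b j) (gaussianReal 0 1) P)
    (hindep : iIndepFun (Sum.elim a b) P)
    (f : Fin (N + 1) → ℂ → ℂ)
    (hf : ∀ j, AnalyticOnNhd ℂ (f j) Set.univ)
    (hreal : ∀ j, ∀ x : ℝ, (f j (x : ℂ)).im = 0) :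
    RandomSum.IsExpectedDensity P f a b 0
      (fun z => (RandomSum.B₀ f z * RandomSum.B₂ f z - ‖RandomSum.B₁ f z‖ ^ 2) /
        (Real.pi * RandomSum.B₀ f z ^ 2)) ∧
    ∀ h : ℂ → ℝ, RandomSum.IsExpectedDensity P f a b 0 h →
      (∀ᵐ z ∂volume.restrict (RandomSum.noCommonZero f),
        h z = (RandomSum.B₀ f z * RandomSum.B₂ f z - ‖RandomSum.B₁ f z‖ ^ 2) /
          (Real.pi * RandomSum.B₀ f z ^ 2)) ∧
      (ContinuousOn h (RandomSum.noCommonZero f) → ∀ z ∈ RandomSum.noCommonZero f,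
        h z = (RandomSum.B₀ f z * RandomSum.B₂ f z - ‖RandomSum.B₁ f z‖ ^ 2) /
          (Real.pi * RandomSum.B₀ f z ^ 2)) := by
  have hd := RandomSum.isExpectedDensity_zeroDensity P a b ha hb hindep f hf
  refine ⟨hd, fun h hh => ?_⟩
  have hU := RandomSum.isOpen_noCommonZero fun j => continuousOn_univ.1 (hf j).continuousOn
  have hae : h =ᵐ[volume.restrict (RandomSum.noCommonZero f)] RandomSum.zeroDensity f :=
    RandomSum.ae_eq_of_setIntegral_isCompact_eq hU (fun K hK hKU => (hh K hK hKU).2.2.1)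
      (fun K hK hKU => (hd K hK hKU).2.2.1)
      (fun K hK hKU => (hh K hK hKU).2.2.2.symm.trans (hd K hK hKU).2.2.2)
  exact ⟨hae, fun hc => Measure.eqOn_open_of_ae_eq hae hU hc
    (RandomSum.continuousOn_zeroDensity hf)⟩
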